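/- Let $k$ be a field, $n\ge 2$, and let $F=\{x^{v_1},\dots,x^{v_n}\}\subset k[x_1,\dots,x_n]$ be a set of $n$ distinct monomials of degree $2$ with no non-trivial common factor, such that every variable divides some member of $F$. Assume that $F$ is a Cremona set, i.e. that $F$ defines a birational map $\mathbb P^{n-1}\dashrightarrow\mathbb P^{n-1}$; equivalently, $k[F]\subset k[\mathbf x_2]$, where $\mathbf x_2$ is the set of all monomials of degree $2$, is an equality on fields of fractions. Let $A_F$ be the log-matrix of $F$ (its columns are $v_1,\dots,v_n$), and let $G_F$ be the graph with vertices $x_1,\dots,x_n$ and edges the members of $F$ (the edge $x_ax_b$ joins $x_a$ to $x_b$, and $x_a^2$ is a loop at $x_a$). Then $G_F$ has exactly one circuit, a loop being counted as a circuit of length $1$; its length $r$ is odd. Call it the root circuit, and call the set of vertices at distance exactly $m$ from it its $m$-th neighborhood. After permuting the variables and the members of $F$, $A_F$ can be put in normal form, meaning: the vertices $x_1,\dots,x_r$ are those of the root circuit and are followed by its first, second, $\dots$ neighborhoods, in this order; the $j$-th monomial is $x_jx_{j+1}$ for $1\le j<r$, and $x_rx_1$ for $j=r$ (so it is $x_1^2$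 if $r=1$); for $j>r$, if $x_j$ lies in the $m$-th neighborhood, then the $j$-th monomial is $x_ix_j$ with $x_i$ in the $(m-1)$-th neighborhood (the $0$-th neighborhood being $\{x_1,\dots,x_r\}$). Moreover there are unique vectors $w_1,\dots,w_n\in\mathbb N^n$ and a unique vector $\gamma\in\mathbb N^n$ such that the monomials $x^{w_1},\dots,x^{w_n}$ have the same degree and no non-trivial common factor, every variable divides some $x^{w_j}$, and $$A_F\cdot A_{F^{-1}}=[\gamma|\cdots|\gamma]+I_n,$$ where $A_{F^{-1}}$, the Cremona inverse matrix, has columns $w_1,\dots,w_n$. The monomials $F^{-1}=\{x^{w_1},\dots,x^{w_n}\}$ define the rational map inverse to the one defined by $F$; substituting the members of $F$ for the variables in $x^{w_j}$ gives $x^\gamma x_j$ for every $j$, and $x^\gamma$ is called the inversion factor. Let $s$ be the number of vertices of $G_F$ off the root circuit that have degree $\ge2$. Then: (a) The inverse map has degree $(r+1)/2+s$, i.e. $x^{w_1},\dots,x^{w_n}$ are forms of this degree without proper common factor. (b) Whenever the variables and the members of $F$ are ordered so that $A_F$ is in normal form, (i) the entries on the main diagonal of $A_{F^{-1}}$ are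 all nonzero; (ii) all entries of $A_{F^{-1}}$ belong to $\{0,1,2\}$, and $2$ occurs in the $i$-th row if and only if the vertex $x_i$ does not belong to the root circuit and has degree $\ge 2$. In particular, the inverse map is defined by squarefree monomials if and only if the second neighborhood of the root circuit is empty. (c) Let $\widetilde{G_F}$ be the subgraph obtained from $G_F$ by omitting the vertices of degree $1$ and the edges incident with them, and let $f_{i_1},\dots,f_{i_m}$ be the monomials corresponding to the edges of $\widetilde{G_F}$ that do not belong to the root circuit. Then the inversion factor is $$x^\gamma=\Big(\prod_{x_i\text{ on the root circuit}}x_i\Big)\,f_{i_1}\cdots f_{i_m}.$$ -/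

import Mathlib

namespace MonomialCremona

/-- The log-set of monomials `x^{v_1}, …, x^{v_n}` in `k[x_1, …, x_n]`. -/
noncomputable def monos (k : Type*) [Field k] {n : ℕ} (v : Fin n → Fin n →₀ ℕ) (j : Fin n) :
    MvPolynomial (Fin n) k :=
  MvPolynomial.monomial (v j) 1

/-- The log-matrix: its columns are the exponent vectors. -/
def logMatrix {n : ℕ} (v : Fin n → Fin n →₀ ℕ) : Matrix (Fin n) (Fin n) ℕ :=
  Matrix.of fun i j => v j i

/-- The monomials have no common factor, and every variable occurs in some monomial. -/
structure CanonicalRestrictions {n : ℕ} (v : Fin n → Fin n →₀ ℕ) : Prop where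
  exists_eq_zero : ∀ i, ∃ j, v j i = 0
  exists_ne_zero : ∀ i, ∃ j, v j i ≠ 0

/-- All exponent vectors have total degree `d`. -/
def IsStochastic {n : ℕ} (d : ℕ) (v : Fin n → Fin n →₀ ℕ) : Prop :=
  ∀ j, (v j).degree = d

/-- The extension `k[F] ⊆ R^{(d)}` of the `d`-th Veronese subring of `R = k[x_1, …, x_n]` is
birational: inside the field of fractions of `R`, the fields generated over `k` by `F` and by all
the monomials of degree `d` coincide. -/
def IsBirational (k : Type*) [Field k] {n : ℕ} (d : ℕ) (v : Fin n → Fin n →₀ ℕ) : Prop :=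
  IntermediateField.adjoin k (Set.range fun j =>
      algebraMap (MvPolynomial (Fin n) k) (FractionRing (MvPolynomial (Fin n) k)) (monos k v j)) =
    IntermediateField.adjoin k ((fun α : Fin n →₀ ℕ =>
      algebraMap (MvPolynomial (Fin n) k) (FractionRing (MvPolynomial (Fin n) k))
        (MvPolynomial.monomial α 1)) '' {α | α.degree = d})

/-- A monomial Cremona set in degree `d`, satisfying the canonical restrictions: `n` distinct
monomials of degree `d` in `n` variables that define a birational map. -/
structure IsCremonaSet (k : Type*) [Field k] {n : ℕ} (d : ℕ) (v : Fin n → Fin n →₀ ℕ) :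
    Prop where
  injective : Function.Injective v
  stochastic : IsStochastic d v
  canonical : CanonicalRestrictions v
  birational : IsBirational k d v

/-- The exponent vectors `w` (whose log-matrix is the Cremona inverse matrix) together with the
inversion vector `γ`: `A_v * A_w = [γ | ⋯ | γ] + I`, where `w` is stochastic and satisfies the
canonical restrictions. The rows of `A_w` are indexed by the monomials of `v`, its columns by the
variables. -/
structure IsCremonaInverse {n : ℕ} (v w : Fin n → Fin n →₀ ℕ) (γ : Fin n →₀ ℕ) : Prop where
  stochastic : ∃ δ, IsStochastic δ w
  canonical : CanonicalRestrictions w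
  inversion : logMatrix v * logMatrix w = Matrix.of (fun i _ => γ i) + 1

/-- The rational map of projective space with coordinates `f` has degree `δ`: the coordinates are
forms of degree `δ` without a proper common factor. -/
def HasMapDegree {k : Type*} [Field k] {n : ℕ} (f : Fin n → MvPolynomial (Fin n) k) (δ : ℕ) :
    Prop :=
  (∀ j, (f j).IsHomogeneous δ) ∧ ∀ p, (∀ j, p ∣ f j) → IsUnit p

/-- The rational map of projective space given by the substitution `x_j ↦ f j` followed by `g` is
the identity, with proportionality factor `h`. -/
def ComposesToId {k : Type*} [Field k] {n : ℕ} (f g : Fin n → MvPolynomial (Fin n) k)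
    (h : MvPolynomial (Fin n) k) : Prop :=
  h ≠ 0 ∧ ∀ j, MvPolynomial.bind₁ f (g j) = h * MvPolynomial.X j

/-- The graph of a set of monomials of degree `2`: the vertices are the variables, the edges are
the monomials, the edge `x_a * x_b` has ends `x_a` and `x_b`, and `x_a ^ 2` is a loop at `x_a`. -/
def graph {n : ℕ} (v : Fin n → Fin n →₀ ℕ) : Graph (Fin n) (Fin n) where
  vertexSet := Set.univ
  IsLink e a b := v e = Finsupp.single a 1 + Finsupp.single b 1
  isLink_symm := fun e _ => ⟨fun a b h => by rw [h, add_comm]⟩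
  eq_or_eq_of_isLink_of_isLink := by
    intro e x y a b h1 h2
    have h := DFunLike.congr_fun (h1.symm.trans h2) x
    by_contra hc
    push Not at hc
    simp [Finsupp.single_apply, hc.1.symm, hc.2.symm] at h
  left_mem_of_isLink := fun _ _ _ _ => Set.mem_univ _

/-- The degree of a vertex, a loop being counted twice. -/
noncomputable def vertexDegree {V E : Type*} (G : Graph V E) (x : V) : ℕ :=
  (G.incidenceSet x).ncard + (G.loopSet x).ncard

/-- `R` and `S` are the vertex set and the edge set of a circuit: distinct vertices
`c_0, …, c_{r-1}` and distinct edges `e_0, …, e_{r-1}`, where `e_i` joins `c_i` to `c_{i+1}`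
(indices modulo `r`). A loop is a circuit of length `r = 1`. -/
def IsCircuit {V E : Type*} (G : Graph V E) (R : Finset V) (S : Finset E) : Prop :=
  ∃ (r : ℕ) (c : Fin r ↪ V) (e : Fin r ↪ E), 0 < r ∧
    (∀ i, G.IsLink (e i) (c i) (c (finRotate r i))) ∧
    R = Finset.univ.map c ∧ S = Finset.univ.map e

/-- `R` and `S` are the vertex set and the edge set of the unique circuit. -/
def IsRootCircuit {V E : Type*} (G : Graph V E) (R : Finset V) (S : Finset E) : Prop :=
  IsCircuit G R S ∧ ∀ R' S', IsCircuit G R' S' → R' = R ∧ S' = S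

/-- The `m`-th neighborhood of a set of vertices: the vertices at distance exactly `m` from it. -/
noncomputable def neighborhood {V E : Type*} (G : Graph V E) (R : Set V) (m : ℕ) : Set V :=
  {x | ⨅ c ∈ R, (SimpleGraph.fromRel G.Adj).edist x c = (m : ℕ∞)}

/-- The subgraph obtained by omitting the vertices of degree `1` and their incident edges. -/
noncomputable def pruned {V E : Type*} (G : Graph V E) : Graph V E :=
  G.deleteVerts {x | vertexDegree G x = 1}

open Classical in
/-- The edges of the pruned graph that do not belong to `S`. -/
noncomputable def prunedEdgesOff {V E : Type*} [Fintype E] (G : Graph V E) (S : Finset E) :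
    Finset E :=
  Finset.univ.filter fun e => e ∈ (pruned G).edgeSet ∧ e ∉ S

/-- The normal form of a Cremona matrix in degree `2`, with root circuit of length `r`. The indices
are split into consecutive blocks by a monotone level function `ℓ`. Block `0` consists of the
indices `0, …, r-1`, and there the `j`-th column is `e_j + e_{j+1 mod r}` (so `2 e_0` if `r = 1`).
A column `j` of a later block has a `1` on the diagonal, exactly one other `1`, in a row of the
preceding block, and zeros elsewhere. -/
def IsNormalForm {n : ℕ} (r : ℕ) (N : Matrix (Fin n) (Fin n) ℕ) : Prop :=
  ∃ ℓ : Fin n → ℕ, Monotone ℓ ∧ (∀ i, ℓ i = 0 ↔ (i : ℕ) < r) ∧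
    (∀ j : Fin n, (j : ℕ) < r → ∀ i : Fin n,
      N i j = (if i = j then 1 else 0) + (if (i : ℕ) = ((j : ℕ) + 1) % r then 1 else 0)) ∧
    (∀ j : Fin n, r ≤ (j : ℕ) → ∃ a : Fin n, ℓ a + 1 = ℓ j ∧ ∀ i : Fin n,
      N i j = (if i = j then 1 else 0) + (if i = a then 1 else 0))

end MonomialCremona

/-!
The argument has four ingredients.

*Birationality as a lattice condition.* If `x ^ α` is a quotient of two polynomials in the members
of `F`, then `α` is an integral combination of the exponent vectors `v j`. Hence a weighting of the
vertices, with values in an abelian group, whose sum over the two ends of every edge is `0`, has sum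
`0` over every pair of vertices (`IsBirational.add_eq_zero`). With rational weights, this makes the
log-matrix `A` invertible.

*The graph as a functional graph.* A nonzero term in the expansion of `det A` is a bijection `τ`
from the vertices to the edges such that `τ x` is incident with `x`. So there is a map `p` on the
vertices such that `τ x` joins `x` to `p x` (`exists_isOrientation`). Weightings with values
in `ZMod 2` and in `ℤ` show that the functional graph of `p` has a single component and an odd cycle
(`IsBirational.isOddUnicyclic`). This cycle, the set of periodic points of `p`, is the only circuit
of the graph (`eq_cycle_of_isCircuit`), and the vertices of degree at least `2` are those in the
range of `p`.

*The inverse matrix.* As the columns of `A` are `e_z + e_{p z}`, an identity `B * A = κ 1ᵀ + I`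
means that `B y z + B y (p z) = [z = y] + κ y`. The number `κ y` is taken to be `1` on the cycle,
`2` for the other vertices in the range of `p`, and `0` for the rest. The recursion is then
solved by an explicit function of the parity of the number of steps from `z` to `y`
(`invWeight`, `invWeight_add`), in which all assertions about entries can be read off. Since
`A * κ = 2 γ` for the asserted inversion vector `γ`, and since `A` is invertible, also
`A * B = γ 1ᵀ + I` (`logMatrix_mul_invExponent`). The degree results from column sums. Uniqueness
holds because two solutions differ by a constant in each row, and every row has minimum `0`.

*Arbitrary normal forms.* A normal form of `A` is itself an orientation `(τ', p')` as above, and the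
inverse matrix built from it is the same by uniqueness. Hence the assertions about the entries
for a given normal form are those about `invWeight p'`.
-/

namespace MonomialCremona

open Function

/-! ### Functional graphs with one odd cycle -/

section Dynamics

variable {V : Type*} {p : V → V} {y z : V}

/-- The least number of iterations of `p` that lead from `z` to `y`; it is `0` by convention when
`z` never reaches `y`. -/
noncomputable def hitTime (p : V → V) (y z : V) : ℕ :=
  sInf {i | p^[i] z = y}

/-- Some iterate of `p` sends `z` to `y`. -/
def Reaches (p : V → V) (z y : V) : Prop :=
  ∃ i, p^[i] z = y

/-- The functional graph of `p` has a single component, and its cycle has odd length. -/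
structure IsOddUnicyclic (p : V → V) : Prop where
  connected : ∀ a b, ∃ i j, p^[i] a = p^[j] b
  odd : ∀ y ∈ periodicPts p, Odd (minimalPeriod p y)

theorem reaches_self (p : V → V) (y : V) : Reaches p y y := ⟨0, rfl⟩

theorem Reaches.of_apply (h : Reaches p (p z) y) : Reaches p z y := by
  obtain ⟨i, hi⟩ := h
  exact ⟨i + 1, hi⟩

theorem Reaches.apply (h : Reaches p z y) (hzy : z ≠ y) : Reaches p (p z) y := by
  obtain ⟨_ | i, hi⟩ := h
  · exact absurd hi hzy
  · exact ⟨i, hi⟩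

theorem mem_periodicPts_iff_reaches : y ∈ periodicPts p ↔ Reaches p (p y) y := by
  constructor
  · rintro ⟨_ | i, hi, h⟩
    · omega
    · exact ⟨i, h⟩
  · rintro ⟨i, hi⟩
    exact ⟨i + 1, i.succ_pos, hi⟩

theorem hitTime_self (p : V → V) (y : V) : hitTime p y y = 0 :=
  Nat.sInf_eq_zero.2 (Or.inl rfl)

theorem hitTime_eq_succ (h : Reaches p z y) (hzy : z ≠ y) :
    hitTime p y z = hitTime p y (p z) + 1 := by
  have h1 : p^[hitTime p y z] z = y := Nat.sInf_mem h
  have h2 : p^[hitTime p y (p z)] (p z) = y := Nat.sInf_mem (h.apply hzy)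
  apply le_antisymm
  · exact Nat.sInf_le (show p^[_ + 1] z = y from h2)
  · rcases hk : hitTime p y z with _ | k
    · rw [hk] at h1
      exact absurd h1 hzy
    · rw [hk] at h1
      exact Nat.succ_le_succ (Nat.sInf_le h1)

theorem hitTime_apply_self (h : y ∈ periodicPts p) :
    hitTime p y (p y) + 1 = minimalPeriod p y := by
  have h2 : p^[hitTime p y (p y)] (p y) = y := Nat.sInf_mem (mem_periodicPts_iff_reaches.1 h)
  apply le_antisymm
  · rcases hk : minimalPeriod p y with _ | k
    · exact absurd (minimalPeriod_pos_of_mem_periodicPts h) (by omega)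
    · have h1 : p^[minimalPeriod p y] y = y := iterate_minimalPeriod
      rw [hk] at h1
      exact Nat.succ_le_succ (Nat.sInf_le h1)
  · exact IsPeriodicPt.minimalPeriod_le (Nat.succ_pos _) h2

theorem reaches_of_iterate_eq {i j : ℕ} (hy : y ∈ periodicPts p) (hij : p^[i] z = p^[j] y) :
    Reaches p z y := by
  have hpos := minimalPeriod_pos_of_mem_periodicPts hy
  refine ⟨(j * minimalPeriod p y - j) + i, ?_⟩
  rw [iterate_add_apply, hij, ← iterate_add_apply,
    Nat.sub_add_cancel (Nat.le_mul_of_pos_right j hpos)]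
  exact (isPeriodicPt_minimalPeriod p y).const_mul j

theorem IsOddUnicyclic.reaches (hp : IsOddUnicyclic p) (hy : y ∈ periodicPts p) (z : V) :
    Reaches p z y := by
  obtain ⟨i, j, hij⟩ := hp.connected z y
  exact reaches_of_iterate_eq hy hij

theorem apply_mem_periodicPts (h : y ∈ periodicPts p) : p y ∈ periodicPts p :=
  (bijOn_periodicPts p).mapsTo h

theorem iterate_mem_periodicPts (h : y ∈ periodicPts p) (i : ℕ) : p^[i] y ∈ periodicPts p :=
  (bijOn_periodicPts p).mapsTo.iterate i h

theorem exists_mem_periodicPts [Finite V] [Nonempty V] (p : V → V) : ∃ y, y ∈ periodicPts p := by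
  obtain ⟨x⟩ := ‹Nonempty V›
  obtain ⟨i, j, hij, h⟩ := Finite.exists_ne_map_eq_of_infinite (fun i : ℕ => p^[i] x)
  wlog hlt : i < j generalizing i j
  · exact this j i hij.symm h.symm (by omega)
  refine ⟨p^[i] x, j - i, by omega, ?_⟩
  change p^[j - i] (p^[i] x) = p^[i] x
  rw [← iterate_add_apply, Nat.sub_add_cancel hlt.le]
  exact h.symm

open Classical in
/-- The constant `κ y` of the recursion `W y z + W y (p z) = [z = y] + κ y` for the entries of the
Cremona inverse matrix: `1` on the cycle of `p`, and off the cycle `2` or `0` according to whether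
`y` is in the range of `p`. -/
noncomputable def rowConst (p : V → V) (y : V) : ℕ :=
  if y ∈ periodicPts p then 1 else if y ∈ Set.range p then 2 else 0

open Classical in
/-- The entry of the Cremona inverse matrix in the row of the edge from `y` to `p y` and in the
column of `z`. Up to the shift of the row by `rowConst p y / 2`, it is the coefficient of this edge
in the expression of `z` as a rational combination of the edges: the edge from `y` to `p y`, if `y`
is first reached after `i` steps from `z`, has the coefficient `(-1) ^ i`, which is halved on the
cycle. -/
noncomputable def invWeight (p : V → V) (y z : V) : ℕ :=
  if y ∈ periodicPts p then if Even (hitTime p y z) then 1 else 0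
  else if y ∈ Set.range p then
    if Reaches p z y then if Even (hitTime p y z) then 2 else 0 else 1
  else if z = y then 1 else 0

open Classical in
/-- Without `rowConst p y`, this would say that the numbers `invWeight p y z` form the inverse of
the matrix with columns `e_z + e_{p z}`; the term accounts for the shift of the row. For `z ≠ y`,
the parity of `hitTime` changes from `z` to `p z`; for `z = y` on the cycle, `hitTime p y (p y)` is
even because the cycle is odd. -/
theorem invWeight_add (hp : IsOddUnicyclic p) (y z : V) :
    invWeight p y z + invWeight p y (p z) = (if z = y then 1 else 0) + rowConst p y := by
  unfold invWeight rowConst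
  by_cases hy : y ∈ periodicPts p
  · simp only [hy, if_true]
    by_cases hzy : z = y
    · subst hzy
      have h1 := hitTime_apply_self hy
      have h2 := hp.odd z hy
      rw [← h1, Nat.odd_add_one, Nat.not_odd_iff_even] at h2
      simp [hitTime_self, h2]
    · simp only [hitTime_eq_succ (hp.reaches hy z) hzy, Nat.even_add_one]
      by_cases h : Even (hitTime p y (p z)) <;> simp [h, hzy]
  · simp only [hy, if_false]
    by_cases hr : y ∈ Set.range p
    · simp only [hr, if_true]
      by_cases hzy : z = y
      · subst hzy
        rw [mem_periodicPts_iff_reaches] at hy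
        simp [hitTime_self, hy, reaches_self]
      · by_cases hzr : Reaches p z y
        · simp only [hitTime_eq_succ hzr hzy, Nat.even_add_one]
          by_cases h : Even (hitTime p y (p z)) <;> simp [h, hzy, hzr, hzr.apply hzy]
        · have : ¬ Reaches p (p z) y := fun h => hzr h.of_apply
          simp [hzr, this, hzy]
    · have : p z ≠ y := fun h => hr ⟨z, h⟩
      simp [hr, this]

theorem invWeight_self_ne_zero (p : V → V) (y : V) : invWeight p y y ≠ 0 := by
  unfold invWeight
  simp only [hitTime_self, reaches_self]
  split_ifs <;> simp_all

theorem invWeight_le_two (p : V → V) (y z : V) : invWeight p y z ≤ 2 := by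
  unfold invWeight
  split_ifs <;> simp

theorem exists_invWeight_eq_two_iff (p : V → V) (y : V) :
    (∃ z, invWeight p y z = 2) ↔ y ∉ periodicPts p ∧ y ∈ Set.range p := by
  constructor
  · rintro ⟨z, hz⟩
    unfold invWeight at hz
    split_ifs at hz <;> simp_all
  · rintro ⟨h1, h2⟩
    refine ⟨y, ?_⟩
    unfold invWeight
    simp only [h1, h2, hitTime_self, reaches_self]
    simp

theorem exists_invWeight_eq_zero [Nontrivial V] (hp : IsOddUnicyclic p) (y : V) :
    ∃ z, invWeight p y z = 0 := by
  classical
  by_cases hy : y ∈ periodicPts p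
  · obtain ⟨z, hz⟩ := exists_ne y
    have h := invWeight_add hp y z
    simp only [rowConst, hy, hz, if_true, if_false] at h
    -- The entries in the columns `z` and `p z` have sum `1`.
    rcases Nat.eq_zero_or_pos (invWeight p y z) with h0 | h0
    · exact ⟨z, h0⟩
    · exact ⟨p z, by omega⟩
  · by_cases hr : y ∈ Set.range p
    · obtain ⟨z, rfl⟩ := hr
      have hz : z ≠ p z := fun h => hy ⟨1, one_pos, show p (p z) = p z by rw [← h]; exact h.symm⟩
      have h := invWeight_add hp (p z) z
      have h2 : invWeight p (p z) (p z) = 2 := by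
        unfold invWeight
        simp [hy, hitTime_self, reaches_self]
      refine ⟨z, ?_⟩
      simp only [rowConst, hy, hz, if_false, Set.mem_range_self, if_true] at h
      omega
    · obtain ⟨z, hz⟩ := exists_ne y
      exact ⟨z, by simp [invWeight, hy, hr, hz]⟩

open Classical in
/-- The set of vertices on the cycle of `p`. -/
noncomputable def cycleFinset [Fintype V] (p : V → V) : Finset V :=
  Finset.univ.filter (· ∈ periodicPts p)

@[simp]
theorem mem_cycleFinset [Fintype V] : y ∈ cycleFinset p ↔ y ∈ periodicPts p := by
  simp [cycleFinset]

/-- The enumeration of the cycle by the iterates of one of its points. -/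
noncomputable def cycleEmb (p : V → V) (c : V) : Fin (minimalPeriod p c) ↪ V where
  toFun i := p^[i] c
  inj' i j h := Fin.ext ((iterate_eq_iterate_iff_of_lt_minimalPeriod i.2 j.2).1 h)

theorem map_cycleEmb [Fintype V] (hp : IsOddUnicyclic p) {c : V} (hc : c ∈ periodicPts p) :
    Finset.univ.map (cycleEmb p c) = cycleFinset p := by
  ext x
  simp only [Finset.mem_map, Finset.mem_univ, true_and, mem_cycleFinset]
  constructor
  · rintro ⟨i, rfl⟩
    exact iterate_mem_periodicPts hc i
  · intro hx
    obtain ⟨i, rfl⟩ := hp.reaches hx c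
    exact ⟨⟨i % minimalPeriod p c, Nat.mod_lt _ (minimalPeriod_pos_of_mem_periodicPts hc)⟩,
      iterate_mod_minimalPeriod_eq⟩

theorem card_cycleFinset [Fintype V] (hp : IsOddUnicyclic p) {c : V} (hc : c ∈ periodicPts p) :
    (cycleFinset p).card = minimalPeriod p c := by
  rw [← map_cycleEmb hp hc, Finset.card_map, Finset.card_univ, Fintype.card_fin]

theorem sum_cycleFinset_apply [Fintype V] {M : Type*} [AddCommMonoid M] (p : V → V) (f : V → M) :
    ∑ y ∈ cycleFinset p, f (p y) = ∑ y ∈ cycleFinset p, f y := by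
  have hb := bijOn_periodicPts p
  refine Finset.sum_bij (fun y _ => p y) (fun y hy => ?_) (fun a ha b hb' h => ?_)
    (fun b hb' => ?_) (fun _ _ => rfl)
  · exact mem_cycleFinset.2 (apply_mem_periodicPts (mem_cycleFinset.1 hy))
  · exact hb.injOn (mem_cycleFinset.1 ha) (mem_cycleFinset.1 hb') h
  · obtain ⟨a, ha, rfl⟩ := hb.surjOn (mem_cycleFinset.1 hb')
    exact ⟨a, mem_cycleFinset.2 ha, rfl⟩

open Classical in
/-- The set of vertices off the cycle that have a preimage under `p`. -/
noncomputable def innerFinset [Fintype V] (p : V → V) : Finset V :=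
  Finset.univ.filter fun y => y ∉ periodicPts p ∧ y ∈ Set.range p

theorem mem_innerFinset [Fintype V] :
    y ∈ innerFinset p ↔ y ∉ periodicPts p ∧ y ∈ Set.range p := by
  simp [innerFinset]

theorem sum_rowConst_smul [Fintype V] {M : Type*} [AddCommMonoid M] (p : V → V) (f : V → M) :
    ∑ y, rowConst p y • f y = ∑ y ∈ cycleFinset p, f y + 2 • ∑ y ∈ innerFinset p, f y := by
  classical
  rw [cycleFinset, innerFinset, Finset.sum_filter, Finset.sum_filter, ← Finset.sum_nsmul,
    ← Finset.sum_add_distrib]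
  refine Finset.sum_congr rfl fun y _ => ?_
  unfold rowConst
  by_cases h1 : y ∈ periodicPts p
  · simp [h1]
  · by_cases h2 : y ∈ Set.range p
    · simp [h1, h2]
    · simp [h1, h2]

end Dynamics

/-! ### The Cremona inverse matrix -/

section Inverse

variable {n : ℕ} {v : Fin n → Fin n →₀ ℕ} {τ : Equiv.Perm (Fin n)} {p : Fin n → Fin n}

/-- The permutation `τ` assigns to every vertex `x` the edge that joins `x` to its parent `p x`.
If `p x = x`, this edge is a loop. -/
def IsOrientation (v : Fin n → Fin n →₀ ℕ) (τ : Equiv.Perm (Fin n)) (p : Fin n → Fin n) : Prop :=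
  ∀ x, v (τ x) = Finsupp.single x 1 + Finsupp.single (p x) 1

/-- The exponent vectors of the inverse map: the edges are numbered by `τ`. -/
noncomputable def invExponent (p : Fin n → Fin n) (τ : Equiv.Perm (Fin n)) (x : Fin n) :
    Fin n →₀ ℕ :=
  Finsupp.equivFunOnFinite.symm fun e => invWeight p (τ.symm e) x

/-- The exponent vector of the product of the vertices on the cycle and of the edges that join the
inner vertices off the cycle to their parents. -/
noncomputable def inversionExponent (p : Fin n → Fin n) : Fin n →₀ ℕ :=
  ∑ x ∈ cycleFinset p, Finsupp.single x 1 +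
    ∑ y ∈ innerFinset p, (Finsupp.single y 1 + Finsupp.single (p y) 1)

@[simp]
theorem invExponent_apply (x e : Fin n) : invExponent p τ x e = invWeight p (τ.symm e) x := rfl

@[simp]
theorem logMatrix_apply (v : Fin n → Fin n →₀ ℕ) (i j : Fin n) : logMatrix v i j = v j i := rfl

theorem logMatrix_invExponent_mul (hv : IsOrientation v τ p) (hp : IsOddUnicyclic p) :
    logMatrix (invExponent p τ) * logMatrix v =
      Matrix.of (fun e _ => rowConst p (τ.symm e)) + 1 := by
  ext e e'
  obtain ⟨z, rfl⟩ := τ.surjective e'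
  have h := invWeight_add hp (τ.symm e) z
  simp only [Matrix.mul_apply, logMatrix_apply, invExponent_apply, hv z, Finsupp.add_apply,
    Finsupp.single_apply, mul_add, Finset.sum_add_distrib, Matrix.add_apply, Matrix.of_apply,
    Matrix.one_apply]
  simp only [mul_ite, mul_one, mul_zero, Finset.sum_ite_eq, Finset.mem_univ, if_true]
  rw [h, add_comm]
  simp only [Equiv.eq_symm_apply, eq_comm]

theorem sum_rowConst_mul (hv : IsOrientation v τ p) (i : Fin n) :
    ∑ e, v e i * rowConst p (τ.symm e) = 2 * inversionExponent p i := by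
  have h : ∑ y, rowConst p y • v (τ y) = 2 • inversionExponent p := by
    have h2 := sum_cycleFinset_apply p fun y => (Finsupp.single y 1 : Fin n →₀ ℕ)
    simp only [hv _, sum_rowConst_smul, inversionExponent]
    rw [Finset.sum_add_distrib, h2, smul_add, two_smul ℕ (∑ y ∈ cycleFinset p, _)]
  have h3 := DFunLike.congr_fun h i
  simp only [Finsupp.finsetSum_apply, Finsupp.smul_apply, smul_eq_mul] at h3
  rw [← h3, ← Equiv.sum_comp τ]
  simp [mul_comm]

theorem IsStochastic.sum_eq {d : ℕ} (h : IsStochastic d v) (j : Fin n) : ∑ i, v j i = d := by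
  rw [← h j, Finsupp.degree_eq_sum]

/-- Since `B * A = κ 1ᵀ + I`, where `κ` is the vector of the `rowConst p y`, and since
`A * κ = 2 γ` and the column sums of `A` are `2`, the matrices `A * B` and `γ 1ᵀ + I` agree after
multiplication by `A` on the right. -/
theorem logMatrix_mul_invExponent (hst : IsStochastic 2 v)
    (hdet : ((logMatrix v).map (Nat.cast : ℕ → ℚ)).det ≠ 0)
    (hv : IsOrientation v τ p) (hp : IsOddUnicyclic p) :
    logMatrix v * logMatrix (invExponent p τ) =
      Matrix.of (fun i _ => inversionExponent p i) + 1 := by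
  have key : (logMatrix v * logMatrix (invExponent p τ)) * logMatrix v =
      (Matrix.of (fun i _ => inversionExponent p i) + 1) * logMatrix v := by
    rw [Matrix.mul_assoc, logMatrix_invExponent_mul hv hp, Matrix.mul_add, Matrix.add_mul,
      Matrix.mul_one, Matrix.one_mul]
    congr 1
    ext i j
    simp only [Matrix.mul_apply, Matrix.of_apply, logMatrix_apply]
    rw [sum_rowConst_mul hv, ← Finset.mul_sum, hst.sum_eq, mul_comm]
  have key2 := congrArg (fun M : Matrix (Fin n) (Fin n) ℕ => M.map (Nat.castRingHom ℚ)) key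
  rw [Matrix.map_mul, Matrix.map_mul, Matrix.map_mul] at key2
  rw [← Matrix.map_mul] at key2
  have hu : IsUnit ((logMatrix v).map (Nat.castRingHom ℚ)) :=
    (Matrix.isUnit_iff_isUnit_det _).2 (isUnit_iff_ne_zero.2 hdet)
  exact Matrix.map_injective Nat.cast_injective (hu.mul_right_cancel key2)

theorem canonicalRestrictions_invExponent [Nontrivial (Fin n)] (hp : IsOddUnicyclic p) :
    CanonicalRestrictions (invExponent p τ) where
  exists_eq_zero e := exists_invWeight_eq_zero hp (τ.symm e)
  exists_ne_zero e := ⟨τ.symm e, invWeight_self_ne_zero p (τ.symm e)⟩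

theorem degree_inversionExponent (p : Fin n → Fin n) :
    ∑ i, inversionExponent p i = (cycleFinset p).card + 2 * (innerFinset p).card := by
  rw [← Finsupp.degree_eq_sum, inversionExponent, map_add, map_sum, map_sum]
  simp [mul_comm]

theorem isStochastic_of_inversion (hst : IsStochastic 2 v) {w : Fin n → Fin n →₀ ℕ}
    (h : logMatrix v * logMatrix w = Matrix.of (fun i _ => inversionExponent p i) + 1) :
    IsStochastic (((cycleFinset p).card + 1) / 2 + (innerFinset p).card) w := by
  intro x
  have h1 : ∑ i, (logMatrix v * logMatrix w) i x =
      ∑ i, (Matrix.of (fun i _ => inversionExponent p i) + 1 : Matrix _ _ ℕ) i x := by rw [h]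
  simp only [Matrix.mul_apply, logMatrix_apply, Matrix.add_apply, Matrix.of_apply,
    Finset.sum_add_distrib, degree_inversionExponent, Matrix.one_apply] at h1
  rw [Finset.sum_comm] at h1
  simp only [← Finset.sum_mul, hst.sum_eq, ← Finset.mul_sum] at h1
  rw [Finsupp.degree_eq_sum]
  simp only [Finset.sum_ite_eq', Finset.mem_univ, if_true] at h1
  omega

theorem isCremonaInverse_invExponent [Nontrivial (Fin n)] (hst : IsStochastic 2 v)
    (hdet : ((logMatrix v).map (Nat.cast : ℕ → ℚ)).det ≠ 0)
    (hv : IsOrientation v τ p) (hp : IsOddUnicyclic p) :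
    IsCremonaInverse v (invExponent p τ) (inversionExponent p) where
  stochastic := ⟨_, isStochastic_of_inversion hst (logMatrix_mul_invExponent hst hdet hv hp)⟩
  canonical := canonicalRestrictions_invExponent hp
  inversion := logMatrix_mul_invExponent hst hdet hv hp

/-- Two Cremona inverse matrices differ in each row by a constant, because `A` maps the differences
of any two of their columns to the same vectors; as every row contains a `0`, they coincide. -/
theorem IsCremonaInverse.unique [NeZero n]
    (hdet : ((logMatrix v).map (Nat.cast : ℕ → ℚ)).det ≠ 0)
    {w w' : Fin n → Fin n →₀ ℕ} {γ γ' : Fin n →₀ ℕ}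
    (h : IsCremonaInverse v w γ) (h' : IsCremonaInverse v w' γ') : w' = w ∧ γ' = γ := by
  have e1 : ∀ {w : Fin n → Fin n →₀ ℕ} {γ : Fin n →₀ ℕ}, IsCremonaInverse v w γ → ∀ i x,
      ∑ e, (v e i : ℚ) * w x e = γ i + if i = x then 1 else 0 := by
    intro w γ h i x
    have := congrFun (congrFun h.inversion i) x
    simp only [Matrix.mul_apply, logMatrix_apply, Matrix.add_apply, Matrix.of_apply,
      Matrix.one_apply] at this
    exact_mod_cast this
  have key : ∀ x y e, (w' x e : ℚ) - w x e = w' y e - w y e := by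
    intro x y
    have h0 : (fun e => ((w' x e : ℚ) - w x e) - (w' y e - w y e)) = 0 := by
      apply Matrix.eq_zero_of_mulVec_eq_zero hdet
      ext i
      simp only [Matrix.mulVec, dotProduct, Matrix.map_apply, logMatrix_apply, mul_sub,
        Finset.sum_sub_distrib, e1 h, e1 h', Pi.zero_apply]
      ring
    intro e
    exact sub_eq_zero.1 (congrFun h0 e)
  have hw : w' = w := by
    ext x e
    obtain ⟨y, hy⟩ := h.canonical.exists_eq_zero e
    obtain ⟨y', hy'⟩ := h'.canonical.exists_eq_zero e
    have k1 := key x y e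
    have k2 := key y y' e
    have p1 : (0 : ℚ) ≤ w' y e := Nat.cast_nonneg _
    have p2 : (0 : ℚ) ≤ w y' e := Nat.cast_nonneg _
    rw [hy, hy'] at k2
    rw [hy] at k1
    simp only [Nat.cast_zero] at k1 k2
    have : (w' x e : ℚ) = w x e := by linarith
    exact_mod_cast this
  refine ⟨hw, ?_⟩
  subst hw
  ext i
  have := (e1 h i 0).symm.trans (e1 h' i 0)
  have : (γ i : ℚ) = γ' i := by linarith
  exact_mod_cast this.symm

end Inverse

open MvPolynomial

/-! ### Monomial maps -/

section Polynomials

variable {k : Type*} [Field k] {n : ℕ} {v w : Fin n → Fin n →₀ ℕ} {γ : Fin n →₀ ℕ}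

theorem exists_X_dvd_of_dvd_monomial {σ : Type*} {q : MvPolynomial σ k} {m : σ →₀ ℕ}
    (h : q ∣ monomial m 1) (hq : ¬ IsUnit q) : ∃ i, X i ∣ q := by
  obtain ⟨m', u, -, hu, rfl⟩ := dvd_monomial_one_iff_exists.1 h
  have hm : m' ≠ 0 := by
    rintro rfl
    exact hq (hu.map C)
  obtain ⟨i, hi⟩ := Finsupp.ne_iff.1 hm
  exact ⟨i, X_dvd_monomial.2 (Or.inr hi)⟩

theorem squarefree_monomial_iff {σ : Type*} {m : σ →₀ ℕ} :
    Squarefree (monomial m 1 : MvPolynomial σ k) ↔ ∀ i, m i ≤ 1 := by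
  have hX : ∀ i, (X i * X i : MvPolynomial σ k) = monomial (Finsupp.single i 2) 1 := by
    intro i
    rw [← pow_two, X_pow_eq_monomial]
  constructor
  · intro h i
    by_contra hc
    have h1 : (X i * X i : MvPolynomial σ k) ∣ monomial m 1 := by
      rw [hX, monomial_one_dvd_monomial_one, Finsupp.single_le_iff]
      omega
    exact X_prime.not_isUnit (h _ h1)
  · intro h q hq
    by_contra hu
    obtain ⟨i, hi⟩ := exists_X_dvd_of_dvd_monomial ((dvd_mul_right q q).trans hq) hu
    have h1 := (mul_dvd_mul hi hi).trans hq
    rw [hX, monomial_one_dvd_monomial_one, Finsupp.single_le_iff] at h1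
    exact absurd (h i) (by omega)

theorem hasMapDegree_monos [NeZero n] {δ : ℕ} (h1 : IsStochastic δ w)
    (h2 : CanonicalRestrictions w) : HasMapDegree (monos k w) δ := by
  refine ⟨fun j => isHomogeneous_monomial _ (h1 j), fun q hq => ?_⟩
  by_contra hu
  obtain ⟨i, hi⟩ := exists_X_dvd_of_dvd_monomial (hq 0) hu
  obtain ⟨j, hj⟩ := h2.exists_eq_zero i
  simpa [hj] using X_dvd_monomial.1 (hi.trans (hq j))

theorem bind₁_monos (v : Fin n → Fin n →₀ ℕ) (m : Fin n →₀ ℕ) :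
    bind₁ (monos k v) (monomial m 1) = monomial (∑ e, m e • v e) 1 := by
  rw [bind₁_monomial, map_one, one_mul, Finset.prod_subset (Finset.subset_univ _)]
  · simp only [monos, monomial_pow, one_pow]
    exact (monomial_sum_one _ _).symm
  · intro i _ hi
    rw [Finsupp.notMem_support_iff.1 hi, pow_zero]

/-- A matrix identity `A * B = γ 1ᵀ + I` between log-matrices amounts to the corresponding monomial
maps composing to the identity, with proportionality factor `x ^ γ`. -/
theorem composesToId_of_mul_eq
    (h : logMatrix v * logMatrix w = Matrix.of (fun i _ => γ i) + 1) :
    ComposesToId (monos k v) (monos k w) (monomial γ 1) := by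
  refine ⟨by simp, fun j => ?_⟩
  have hj : ∑ e, w j e • v e = γ + Finsupp.single j 1 := by
    ext i
    have := congrFun (congrFun h i) j
    simp only [Matrix.mul_apply, logMatrix_apply, Matrix.add_apply, Matrix.of_apply,
      Matrix.one_apply] at this
    simp only [Finsupp.finsetSum_apply, Finsupp.smul_apply, smul_eq_mul, Finsupp.add_apply,
      Finsupp.single_apply, eq_comm (a := j), ← this, mul_comm]
  rw [monos, bind₁_monos, hj, X, monomial_mul, one_mul]

theorem monomial_inversionExponent {τ : Equiv.Perm (Fin n)} {p : Fin n → Fin n}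
    (hv : IsOrientation v τ p) :
    (monomial (inversionExponent p) 1 : MvPolynomial (Fin n) k) =
      (∏ x ∈ cycleFinset p, X x) * ∏ e ∈ (innerFinset p).map τ.toEmbedding, monos k v e := by
  rw [inversionExponent, Finset.prod_map]
  simp only [Equiv.coe_toEmbedding, monos, hv _, X]
  rw [← monomial_sum_one, ← monomial_sum_one, monomial_mul, one_mul]

end Polynomials

/-! ### Birationality and orientations -/

section Lattice

variable {k : Type*} [Field k] {n d : ℕ} {v : Fin n → Fin n →₀ ℕ}

/-- If a monomial is a quotient of two polynomials in the monomials `x ^ v j`, then its exponent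
vector is an integral combination of the `v j`: an additive map that vanishes on the `v j` vanishes
on the exponents of the numerator and of the denominator. -/
theorem IsBirational.map_eq_zero (hF : IsBirational k d v) {M : Type*} [AddCommGroup M]
    (Φ : (Fin n →₀ ℕ) →+ M) (hΦ : ∀ j, Φ (v j) = 0) {α : Fin n →₀ ℕ} (hα : α.degree = d) :
    Φ α = 0 := by
  set K := FractionRing (MvPolynomial (Fin n) k)
  set ι := algebraMap (MvPolynomial (Fin n) k) K
  have hι : Injective ι := IsFractionRing.injective _ _
  have hadj : ∀ r ∈ Algebra.adjoin k (Set.range fun j => ι (monos k v j)),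
      ∃ r', ι r' = r ∧ ∀ m ∈ r'.support, Φ m = 0 := by
    classical
    intro r hr
    induction hr using Algebra.adjoin_induction with
    | mem x hx =>
      obtain ⟨j, rfl⟩ := hx
      refine ⟨_, rfl, fun m hm => ?_⟩
      rw [Finset.mem_singleton.1 (support_monomial_subset hm), hΦ]
    | algebraMap c =>
      refine ⟨C c, ?_, fun m hm => ?_⟩
      · exact (IsScalarTower.algebraMap_apply k (MvPolynomial (Fin n) k) K c).symm
      · rw [Finset.mem_singleton.1 (support_monomial_subset hm), map_zero]
    | add x y _ _ hx hy =>
      obtain ⟨x', rfl, hx⟩ := hx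
      obtain ⟨y', rfl, hy⟩ := hy
      refine ⟨x' + y', map_add _ _ _, fun m hm => ?_⟩
      rcases Finset.mem_union.1 (support_add hm) with h | h
      · exact hx m h
      · exact hy m h
    | mul x y _ _ hx hy =>
      obtain ⟨x', rfl, hx⟩ := hx
      obtain ⟨y', rfl, hy⟩ := hy
      refine ⟨x' * y', map_mul _ _ _, fun m hm => ?_⟩
      obtain ⟨a, ha, b, hb, rfl⟩ := Finset.mem_add.1 (support_mul x' y' hm)
      rw [map_add, hx a ha, hy b hb, add_zero]
  have hmem : ι (monomial α 1) ∈ IntermediateField.adjoin k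
      (Set.range fun j => ι (monos k v j)) := by
    have hF' := hF
    unfold IsBirational at hF'
    rw [hF']
    exact IntermediateField.subset_adjoin _ _ ⟨α, hα, rfl⟩
  obtain ⟨r, hr, s, hs, hrs⟩ := IntermediateField.mem_adjoin_iff_div.1 hmem
  obtain ⟨r', rfl, hr'⟩ := hadj r hr
  obtain ⟨s', rfl, hs'⟩ := hadj s hs
  have hs0 : s' ≠ 0 := by
    rintro rfl
    rw [map_zero, div_zero, map_eq_zero_iff ι hι] at hrs
    simp at hrs
  have hs1 : ι s' ≠ 0 := (map_ne_zero_iff ι hι).2 hs0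
  have heq : monomial α 1 * s' = r' := by
    apply hι
    rw [map_mul, hrs, div_mul_cancel₀ _ hs1]
  obtain ⟨m, hm⟩ := support_nonempty.2 hs0
  have h1 : Φ (α + m) = 0 := by
    apply hr'
    rw [mem_support_iff, ← heq, coeff_monomial_mul, one_mul]
    exact mem_support_iff.1 hm
  rwa [map_add, hs' m hm, add_zero] at h1

/-- The form in which the birationality is used: a vertex weighting that vanishes on all the edges
vanishes on all pairs of vertices. -/
theorem IsBirational.add_eq_zero (hF : IsBirational k 2 v) {M : Type*} [AddCommGroup M]
    (g : Fin n → M) (hg : ∀ j, ∑ i, v j i • g i = 0) (a b : Fin n) : g a + g b = 0 := by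
  let Φ : (Fin n →₀ ℕ) →+ M :=
    { toFun := fun m => ∑ i, m i • g i
      map_zero' := by simp
      map_add' := fun x y => by simp [add_smul, Finset.sum_add_distrib] }
  have h := hF.map_eq_zero Φ hg (α := Finsupp.single a 1 + Finsupp.single b 1)
    (by rw [map_add, Finsupp.degree_single, Finsupp.degree_single])
  have hs : ∀ c, ∑ i, (Finsupp.single c 1 : Fin n →₀ ℕ) i • g i = g c := by
    intro c
    rw [Finset.sum_eq_single c] <;> simp +contextual [eq_comm]
  rw [map_add] at h
  rwa [← hs a, ← hs b]

theorem IsBirational.det_ne_zero (hF : IsBirational k 2 v) :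
    ((logMatrix v).map (Nat.cast : ℕ → ℚ)).det ≠ 0 := by
  intro h
  obtain ⟨g, hg0, hg⟩ := Matrix.exists_vecMul_eq_zero_iff.2 h
  apply hg0
  ext a
  have := hF.add_eq_zero g (fun j => by
    have := congrFun hg j
    simpa [Matrix.vecMul, dotProduct, mul_comm] using this) a a
  simpa using this

/-- A nonzero term in the expansion of the determinant assigns to every vertex an edge incident
with it. -/
theorem exists_isOrientation (hst : IsStochastic 2 v)
    (hdet : ((logMatrix v).map (Nat.cast : ℕ → ℚ)).det ≠ 0) :
    ∃ τ p, IsOrientation v τ p := by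
  obtain ⟨σ, -, hσ⟩ := Finset.exists_ne_zero_of_sum_ne_zero (by rwa [Matrix.det_apply] at hdet)
  have hprod : ∀ j, v j (σ j) ≠ 0 := by
    intro j hj
    apply hσ
    rw [Finset.prod_eq_zero (Finset.mem_univ j), smul_zero]
    simp [hj]
  have hex : ∀ x, ∃ y, v (σ.symm x) = Finsupp.single x 1 + Finsupp.single y 1 := by
    intro x
    have hle : Finsupp.single x 1 ≤ v (σ.symm x) := by
      rw [Finsupp.single_le_iff, Nat.one_le_iff_ne_zero]
      simpa using hprod (σ.symm x)
    obtain ⟨m, hm⟩ := exists_add_of_le hle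
    have hd := hst (σ.symm x)
    rw [hm, map_add, Finsupp.degree_single] at hd
    have hm1 : m ∈ {d : Fin n →₀ ℕ | d.degree = 1} := show m.degree = 1 by omega
    rw [← Finsupp.range_single_one] at hm1
    obtain ⟨y, rfl⟩ := hm1
    exact ⟨y, hm⟩
  choose p hp using hex
  exact ⟨σ.symm, p, hp⟩

theorem IsOrientation.sum_smul {τ : Equiv.Perm (Fin n)} {p : Fin n → Fin n} {M : Type*}
    [AddCommMonoid M] (hv : IsOrientation v τ p) (g : Fin n → M) (x : Fin n) :
    ∑ i, v (τ x) i • g i = g x + g (p x) := by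
  simp [hv x, add_smul, Finset.sum_add_distrib, Finsupp.single_apply, ite_smul]

/-- If the component of a vertex `b` were not everything, then its indicator function modulo `2`
would vanish on all the edges, but not on all the pairs of vertices. If the cycle were even, then a
coloring by the signs `1` and `-1` in which `x` and `p x` always differ would vanish on all the
edges, but not on a pair of equal vertices. -/
theorem IsBirational.isOddUnicyclic (hF : IsBirational k 2 v) {τ : Equiv.Perm (Fin n)}
    {p : Fin n → Fin n} (hv : IsOrientation v τ p) : IsOddUnicyclic p := by
  classical
  have hconn : ∀ a b, ∃ i j, p^[i] a = p^[j] b := by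
    intro a b
    let g : Fin n → ZMod 2 := fun x => if ∃ i j, p^[i] x = p^[j] b then 1 else 0
    have hstep : ∀ x, (∃ i j, p^[i] (p x) = p^[j] b) ↔ ∃ i j, p^[i] x = p^[j] b := by
      intro x
      constructor
      · rintro ⟨i, j, h⟩
        exact ⟨i + 1, j, h⟩
      · rintro ⟨i, j, h⟩
        refine ⟨i, j + 1, ?_⟩
        rw [iterate_succ_apply' p j, ← h, ← iterate_succ_apply' p i, iterate_succ_apply]
    have h := hF.add_eq_zero g (fun j => by
      obtain ⟨x, rfl⟩ := τ.surjective j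
      rw [hv.sum_smul]
      simp only [g, hstep]
      exact CharTwo.add_self_eq_zero _) a b
    by_contra hc
    have hb : ∃ i j, p^[i] b = p^[j] b := ⟨0, 0, rfl⟩
    simp [g, hc, hb] at h
  refine ⟨hconn, fun y hy => ?_⟩
  by_contra hodd
  have hreach : ∀ z, Reaches p z y := by
    intro z
    obtain ⟨i, j, hij⟩ := hconn z y
    exact reaches_of_iterate_eq hy hij
  have h := hF.add_eq_zero (fun z => (-1 : ℤ) ^ hitTime p y z) (fun j => by
    obtain ⟨x, rfl⟩ := τ.surjective j
    rw [hv.sum_smul]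
    by_cases hxy : x = y
    · subst hxy
      have h1 := hitTime_apply_self hy
      rw [← h1, Nat.odd_add_one, not_not] at hodd
      rw [hitTime_self, hodd.neg_one_pow]
      simp
    · rw [hitTime_eq_succ (hreach x) hxy, pow_succ]
      ring) y y
  simp [hitTime_self] at h

end Lattice

/-! ### The graph of the monomials -/

section GraphTheory

variable {n : ℕ} {v : Fin n → Fin n →₀ ℕ} {τ : Equiv.Perm (Fin n)} {p : Fin n → Fin n}

theorem IsOrientation.isLink (hv : IsOrientation v τ p) (z : Fin n) :
    (graph v).IsLink (τ z) z (p z) := hv z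

theorem IsOrientation.isLink_iff (hv : IsOrientation v τ p) {z a b : Fin n} :
    (graph v).IsLink (τ z) a b ↔ a = z ∧ b = p z ∨ a = p z ∧ b = z := by
  constructor
  · intro h
    exact h.eq_and_eq_or_eq_and_eq (hv.isLink z)
  · rintro (⟨rfl, rfl⟩ | ⟨rfl, rfl⟩)
    · exact hv.isLink _
    · exact (hv.isLink _).symm

theorem IsOrientation.inc_iff (hv : IsOrientation v τ p) {z x : Fin n} :
    (graph v).Inc (τ z) x ↔ x = z ∨ x = p z := by
  simp only [Graph.Inc, hv.isLink_iff]
  aesop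

theorem IsOrientation.adj_iff (hv : IsOrientation v τ p) {a b : Fin n} :
    (graph v).Adj a b ↔ b = p a ∨ a = p b := by
  constructor
  · rintro ⟨e, he⟩
    obtain ⟨z, rfl⟩ := τ.surjective e
    rcases hv.isLink_iff.1 he with ⟨rfl, rfl⟩ | ⟨rfl, rfl⟩ <;> simp
  · rintro (rfl | rfl)
    · exact ⟨_, hv.isLink _⟩
    · exact ⟨_, (hv.isLink _).symm⟩

theorem IsOrientation.two_le_vertexDegree (hv : IsOrientation v τ p) {x : Fin n}
    (hx : x ∈ Set.range p) : 2 ≤ vertexDegree (graph v) x := by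
  obtain ⟨z, rfl⟩ := hx
  unfold vertexDegree
  by_cases hz : z = p z
  · have h1 : 0 < ((graph v).incidenceSet (p z)).ncard :=
      (Set.ncard_pos).2 ⟨τ z, hv.inc_iff.2 (Or.inr rfl)⟩
    have h2 : 0 < ((graph v).loopSet (p z)).ncard :=
      (Set.ncard_pos).2 ⟨τ z, hv.isLink_iff.2 (Or.inl ⟨hz.symm, rfl⟩)⟩
    omega
  · have h1 : ({τ z, τ (p z)} : Set (Fin n)) ⊆ (graph v).incidenceSet (p z) := by
      rintro e (rfl | rfl)
      · exact hv.inc_iff.2 (Or.inr rfl)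
      · exact hv.inc_iff.2 (Or.inl rfl)
    have h2 := Set.ncard_le_ncard h1
    rw [Set.ncard_pair (fun h => hz (τ.injective h))] at h2
    omega

theorem IsOrientation.vertexDegree_eq_one (hv : IsOrientation v τ p) {x : Fin n}
    (hx : x ∉ Set.range p) : vertexDegree (graph v) x = 1 := by
  have h1 : (graph v).incidenceSet x = {τ x} := by
    ext e
    obtain ⟨z, rfl⟩ := τ.surjective e
    rw [Graph.mem_incidenceSet, hv.inc_iff, Set.mem_singleton_iff, τ.apply_eq_iff_eq]
    constructor
    · rintro (rfl | rfl)
      · rfl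
      · exact absurd ⟨z, rfl⟩ hx
    · rintro rfl
      exact Or.inl rfl
  have h2 : (graph v).loopSet x = ∅ := by
    ext e
    obtain ⟨z, rfl⟩ := τ.surjective e
    simp only [Graph.mem_loopSet, Graph.IsLoopAt, hv.isLink_iff, Set.mem_empty_iff_false, iff_false]
    rintro (⟨-, h⟩ | ⟨h, -⟩) <;> exact hx ⟨z, h.symm⟩
  rw [vertexDegree, h1, h2, Set.ncard_singleton, Set.ncard_empty]

theorem IsOrientation.two_le_vertexDegree_iff (hv : IsOrientation v τ p) {x : Fin n} :
    2 ≤ vertexDegree (graph v) x ↔ x ∈ Set.range p := by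
  refine ⟨fun h => ?_, hv.two_le_vertexDegree⟩
  by_contra hx
  rw [hv.vertexDegree_eq_one hx] at h
  omega

theorem IsOrientation.vertexDegree_eq_one_iff (hv : IsOrientation v τ p) {x : Fin n} :
    vertexDegree (graph v) x = 1 ↔ x ∉ Set.range p := by
  refine ⟨fun h hx => ?_, hv.vertexDegree_eq_one⟩
  have := hv.two_le_vertexDegree hx
  omega

theorem mem_prunedEdgesOff {V E : Type*} [Fintype E] {G : Graph V E} {S : Finset E} {e : E} :
    e ∈ prunedEdgesOff G S ↔ e ∈ (pruned G).edgeSet ∧ e ∉ S := by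
  simp [prunedEdgesOff]

theorem IsOrientation.prunedEdgesOff_eq (hv : IsOrientation v τ p) :
    prunedEdgesOff (graph v) ((cycleFinset p).map τ.toEmbedding) =
      (innerFinset p).map τ.toEmbedding := by
  ext e
  obtain ⟨z, rfl⟩ := τ.surjective e
  have h1 : τ z ∈ (innerFinset p).map τ.toEmbedding ↔ z ∈ innerFinset p :=
    Finset.mem_map' τ.toEmbedding
  have h2 : τ z ∈ (cycleFinset p).map τ.toEmbedding ↔ z ∈ cycleFinset p :=
    Finset.mem_map' τ.toEmbedding
  rw [mem_prunedEdgesOff, h1, h2, mem_cycleFinset, mem_innerFinset, and_comm,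
    pruned, Graph.edgeSet_deleteVerts]
  simp only [Set.mem_ofPred_eq, hv.vertexDegree_eq_one_iff, not_not, hv.isLink_iff]
  refine and_congr_right fun _ => ⟨?_, fun h => ⟨z, p z, Or.inl ⟨rfl, rfl⟩, h, z, rfl⟩⟩
  rintro ⟨a, b, ⟨rfl, rfl⟩ | ⟨rfl, rfl⟩, ha, hb⟩
  · exact ha
  · exact hb

theorem isCircuit_cycle (hv : IsOrientation v τ p) (hp : IsOddUnicyclic p) {c : Fin n}
    (hc : c ∈ periodicPts p) :
    IsCircuit (graph v) (cycleFinset p) ((cycleFinset p).map τ.toEmbedding) := by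
  have hpos := minimalPeriod_pos_of_mem_periodicPts hc
  refine ⟨minimalPeriod p c, cycleEmb p c, (cycleEmb p c).trans τ.toEmbedding, hpos, fun i => ?_,
    (map_cycleEmb hp hc).symm, ?_⟩
  · have : cycleEmb p c (finRotate _ i) = p (cycleEmb p c i) := by
      have : NeZero (minimalPeriod p c) := ⟨hpos.ne'⟩
      rw [finRotate_apply]
      change p^[((i + 1 : Fin (minimalPeriod p c)) : ℕ)] c = p (p^[i] c)
      rw [Fin.val_add, Fin.val_one', Nat.add_mod_mod, iterate_mod_minimalPeriod_eq,
        iterate_succ_apply']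
    rw [this]
    exact hv.isLink _
  · rw [← map_cycleEmb hp hc, Finset.map_map]

/-- The orientation attaches every edge of a circuit to one of its ends, so that the vertices and
the edges of the circuit are in bijection. As every vertex of the circuit lies on two edges
of it (or on a loop), `p` maps the circuit onto itself, so the circuit consists of periodic points
of `p`. -/
theorem eq_cycle_of_isCircuit (hv : IsOrientation v τ p) (hp : IsOddUnicyclic p)
    {R S : Finset (Fin n)} (h : IsCircuit (graph v) R S) :
    R = cycleFinset p ∧ S = (cycleFinset p).map τ.toEmbedding := by
  obtain ⟨r, c, e, hr, hlink, hR, hS⟩ := h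
  let t : Fin r → Fin n := fun i => τ.symm (e i)
  have ht : ∀ i, τ (t i) = e i := fun i => τ.apply_symm_apply _
  have htinj : Injective t := τ.symm.injective.comp e.injective
  have hends : ∀ i, c i = t i ∧ c (finRotate r i) = p (t i) ∨
      c i = p (t i) ∧ c (finRotate r i) = t i := by
    intro i
    have := hlink i
    rwa [← ht, hv.isLink_iff] at this
  have hmem : ∀ i, c i ∈ R := fun i => by rw [hR]; exact Finset.mem_map_of_mem _ (Finset.mem_univ _)
  have htR : Finset.univ.image t = R := by
    apply Finset.eq_of_subset_of_card_le
    · intro x hx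
      obtain ⟨i, -, rfl⟩ := Finset.mem_image.1 hx
      rcases hends i with ⟨h, -⟩ | ⟨-, h⟩ <;> rw [← h] <;> exact hmem _
    · rw [Finset.card_image_of_injective _ htinj, hR, Finset.card_map]
  have hpt : ∀ i, p (t i) ∈ R := by
    intro i
    rcases hends i with ⟨-, h⟩ | ⟨h, -⟩ <;> rw [← h] <;> exact hmem _
  have hmaps : Set.MapsTo p R R := by
    intro x hx
    rw [← htR] at hx
    obtain ⟨i, -, rfl⟩ := Finset.mem_image.1 (Finset.mem_coe.1 hx)
    exact hpt i
  have hsurj : Set.SurjOn p R R := by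
    intro x hx
    obtain ⟨i, -, rfl⟩ := Finset.mem_map.1 (hR ▸ Finset.mem_coe.1 hx)
    have htm : ∀ j, t j ∈ R := fun j => by
      rw [← htR]; exact Finset.mem_image_of_mem _ (Finset.mem_univ _)
    -- Of the edges numbered `i` and `i - 1`, one is not attached to `c i`, unless they coincide.
    rcases hends i with ⟨h1, h2⟩ | ⟨h1, -⟩
    · obtain ⟨j, rfl⟩ := (finRotate r).surjective i
      rcases hends j with ⟨-, h3⟩ | ⟨h3, h4⟩
      · exact ⟨t j, htm j, h3.symm⟩
      · have hj := htinj (h4.symm.trans h1)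
        rw [← hj] at h2
        exact ⟨t j, htm j, by rw [← h3, ← hj]⟩
    · exact ⟨t i, htm i, h1.symm⟩
  have hinj : Set.InjOn p R := Finset.injOn_of_surjOn_of_card_le p hmaps hsurj le_rfl
  have hsub : R ⊆ cycleFinset p := by
    intro x hx
    rw [mem_cycleFinset]
    obtain ⟨i, j, hij, hlt⟩ : ∃ i j : ℕ, p^[i] x = p^[j] x ∧ i < j := by
      obtain ⟨i, j, hij, h⟩ := Finite.exists_ne_map_eq_of_infinite (fun i : ℕ => p^[i] x)
      rcases hij.lt_or_gt with h' | h'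
      · exact ⟨i, j, h, h'⟩
      · exact ⟨j, i, h.symm, h'⟩
    refine ⟨j - i, by omega, ?_⟩
    apply (hinj.iterate hmaps i) ((hmaps.iterate (j - i)) hx) hx
    rw [← iterate_add_apply, Nat.add_sub_cancel' hlt.le]
    exact hij.symm
  have hRc : R = cycleFinset p := by
    refine hsub.antisymm fun y hy => ?_
    obtain ⟨i, hi⟩ := hp.reaches (mem_cycleFinset.1 hy) (c ⟨0, hr⟩)
    rw [← hi]
    exact hmaps.iterate i (hmem _)
  refine ⟨hRc, ?_⟩
  rw [← hRc, ← htR, hS]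
  ext x
  simp only [Finset.mem_map, Finset.mem_image, Finset.mem_univ, true_and, Equiv.coe_toEmbedding,
    exists_exists_eq_and, ht]

theorem isRootCircuit_cycle (hv : IsOrientation v τ p) (hp : IsOddUnicyclic p) {c : Fin n}
    (hc : c ∈ periodicPts p) :
    IsRootCircuit (graph v) (cycleFinset p) ((cycleFinset p).map τ.toEmbedding) :=
  ⟨isCircuit_cycle hv hp hc, fun _ _ h => eq_cycle_of_isCircuit hv hp h⟩

/-- The distance of `x` from the cycle, measured along the iterates of `p`. -/
noncomputable def level {V : Type*} (p : V → V) (x : V) : ℕ :=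
  sInf {i | p^[i] x ∈ periodicPts p}

theorem IsOddUnicyclic.exists_iterate_mem (hp : IsOddUnicyclic p) {c : Fin n}
    (hc : c ∈ periodicPts p) (x : Fin n) : ∃ i, p^[i] x ∈ periodicPts p := by
  obtain ⟨i, rfl⟩ := hp.reaches hc x
  exact ⟨i, hc⟩

theorem level_eq_zero_iff (hp : ∀ x, ∃ i, p^[i] x ∈ periodicPts p) (x : Fin n) :
    level p x = 0 ↔ x ∈ periodicPts p := by
  rw [level, Nat.sInf_eq_zero]
  constructor
  · rintro (h | h)
    · exact h
    · obtain ⟨i, hi⟩ := hp x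
      exact absurd (show i ∈ (∅ : Set ℕ) from h ▸ hi) (Set.notMem_empty i)
  · intro h
    exact Or.inl h

theorem level_apply_add_one (hp : ∀ x, ∃ i, p^[i] x ∈ periodicPts p) {x : Fin n}
    (hx : x ∉ periodicPts p) : level p (p x) + 1 = level p x := by
  have h1 : p^[level p x] x ∈ periodicPts p := Nat.sInf_mem (hp x)
  have h2 : p^[level p (p x)] (p x) ∈ periodicPts p := Nat.sInf_mem (hp (p x))
  apply le_antisymm
  · rcases hk : level p x with _ | i
    · exact absurd ((level_eq_zero_iff hp x).1 hk) hx
    · rw [hk] at h1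
      exact Nat.succ_le_succ (Nat.sInf_le h1)
  · exact Nat.sInf_le (show p^[_ + 1] x ∈ periodicPts p from h2)

/-- The second neighborhood of the cycle consists of the vertices of level `2`. If a vertex off the
cycle has a preimage under `p`, then some iterate of this preimage has level `2`. -/
theorem neighborhood_two_eq_empty_iff (hv : IsOrientation v τ p) (hp : IsOddUnicyclic p)
    {c : Fin n} (hc : c ∈ periodicPts p) :
    neighborhood (graph v) (cycleFinset p : Set (Fin n)) 2 = ∅ ↔
      ∀ y, y ∈ Set.range p → y ∈ periodicPts p := by
  have hex := hp.exists_iterate_mem hc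
  have hadj : ∀ x, x ≠ p x → (SimpleGraph.fromRel (graph v).Adj).Adj x (p x) := fun x hx =>
    (SimpleGraph.fromRel_adj _ _ _).2 ⟨hx, Or.inl (hv.adj_iff.2 (Or.inl rfl))⟩
  have hle : ∀ x, (SimpleGraph.fromRel (graph v).Adj).edist x (p x) ≤ 1 := by
    intro x
    rw [SimpleGraph.edist_le_one_iff_adj_or_eq]
    by_cases hx : x = p x
    · exact Or.inr hx
    · exact Or.inl (hadj x hx)
  constructor
  · rintro h y ⟨z, rfl⟩
    by_contra hy
    have hlz : level p (p z) + 1 = level p z := level_apply_add_one hex fun hz =>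
      hy (apply_mem_periodicPts hz)
    have hly : level p (p z) ≠ 0 := fun h => hy ((level_eq_zero_iff hex _).1 h)
    have hdesc : ∀ m x, level p x = m + 2 → ∃ x, level p x = 2 := by
      intro m
      induction m with
      | zero => exact fun x hx => ⟨x, hx⟩
      | succ m ih =>
        intro x hx
        refine ih (p x) ?_
        have := level_apply_add_one hex (x := x) fun h => by
          rw [(level_eq_zero_iff hex x).2 h] at hx
          omega
        omega
    obtain ⟨x, hx⟩ := hdesc (level p z - 2) z (by omega)
    have hx0 : x ∉ periodicPts p := fun h => by
      rw [(level_eq_zero_iff hex x).2 h] at hx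
      omega
    have hx1 := level_apply_add_one hex hx0
    have hpx : p x ∉ periodicPts p := fun h => by
      rw [(level_eq_zero_iff hex _).2 h] at hx1
      omega
    have hx2 := level_apply_add_one hex hpx
    have hppx : p (p x) ∈ periodicPts p := (level_eq_zero_iff hex _).1 (by omega)
    apply Set.notMem_empty x
    rw [← h]
    apply le_antisymm
    · refine (iInf₂_le (p (p x)) (mem_cycleFinset.2 hppx)).trans ?_
      refine SimpleGraph.edist_triangle.trans ((add_le_add (hle x) (hle (p x))).trans ?_)
      norm_num
    · refine le_iInf₂ fun d hd => ?_
      have hd : d ∈ periodicPts p := mem_cycleFinset.1 hd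
      by_contra hlt
      have hlt1 : (SimpleGraph.fromRel (graph v).Adj).edist x d ≤ 1 :=
        Order.le_of_lt_add_one (by simpa [one_add_one_eq_two] using hlt)
      rcases SimpleGraph.edist_le_one_iff_adj_or_eq.1 hlt1 with h1 | rfl
      · have h2 := ((SimpleGraph.fromRel_adj _ _ _).1 h1).2
        simp only [hv.adj_iff] at h2
        have h3 : d = p x ∨ x = p d := by tauto
        rcases h3 with rfl | rfl
        · exact hpx hd
        · exact hx0 (apply_mem_periodicPts hd)
      · exact hx0 hd
  · intro h
    rw [Set.eq_empty_iff_forall_notMem]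
    intro x hx
    have hpx : p x ∈ periodicPts p := h _ ⟨x, rfl⟩
    have h1 := iInf₂_le (f := fun d (_ : d ∈ (cycleFinset p : Set (Fin n))) =>
      (SimpleGraph.fromRel (graph v).Adj).edist x d) (p x) (mem_cycleFinset.2 hpx)
    have h2 := h1.trans (hle x)
    rw [show (⨅ d ∈ (cycleFinset p : Set (Fin n)),
      (SimpleGraph.fromRel (graph v).Adj).edist x d) = ((2 : ℕ) : ℕ∞) from hx] at h2
    norm_num at h2

end GraphTheory

/-! ### Normal forms -/

section NormalForm

variable {n : ℕ} {v : Fin n → Fin n →₀ ℕ} {τ : Equiv.Perm (Fin n)} {p : Fin n → Fin n}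

/-- A normal form of the log-matrix orients the graph. -/
theorem IsNormalForm.exists_isOrientation {r : ℕ} (hr : r ≤ n) {σ τ : Equiv.Perm (Fin n)}
    (h : IsNormalForm r ((logMatrix v).submatrix σ τ)) :
    ∃ p, IsOrientation v (σ.symm.trans τ) p := by
  obtain ⟨ℓ, -, -, h1, h2⟩ := h
  have key : ∀ j, ∃ a, ∀ i, v (τ j) (σ i) = (if i = j then 1 else 0) + if i = a then 1 else 0 := by
    intro j
    by_cases hj : (j : ℕ) < r
    · have hn : ((j : ℕ) + 1) % r < n := (Nat.mod_lt _ (by omega)).trans_le hr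
      refine ⟨⟨_, hn⟩, fun i => ?_⟩
      simpa [Fin.ext_iff] using h1 j hj i
    · obtain ⟨a, -, ha⟩ := h2 j (not_lt.1 hj)
      exact ⟨a, ha⟩
  choose a ha using key
  refine ⟨fun x => σ (a (σ.symm x)), fun x => ?_⟩
  ext y
  have := ha (σ.symm x) (σ.symm y)
  simp only [Equiv.apply_symm_apply, EmbeddingLike.apply_eq_iff_eq] at this
  simp only [Equiv.trans_apply, this, Finsupp.add_apply, Finsupp.single_apply, eq_comm (b := y)]
  simp only [Equiv.symm_apply_eq]

/-- The vertices are sorted by the function that numbers the cycle by `0, …, r - 1` and that takes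
the value `r + m` at the vertices of level `m` off the cycle. -/
theorem exists_isNormalForm (hv : IsOrientation v τ p) (hp : IsOddUnicyclic p) {c : Fin n}
    (hc : c ∈ periodicPts p) :
    ∃ σ τ : Equiv.Perm (Fin n),
      IsNormalForm (cycleFinset p).card ((logMatrix v).submatrix σ τ) := by
  rw [card_cycleFinset hp hc]
  set r := minimalPeriod p c with hrdef
  have hpos : 0 < r := minimalPeriod_pos_of_mem_periodicPts hc
  have hex := hp.exists_iterate_mem hc
  have hf : ∀ x, ∃ m, (x ∈ periodicPts p → m < r ∧ p^[m] c = x) ∧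
      (x ∉ periodicPts p → m = r + level p x) := by
    intro x
    by_cases hx : x ∈ periodicPts p
    · obtain ⟨i, rfl⟩ := hp.reaches hx c
      exact ⟨i % r, fun _ => ⟨Nat.mod_lt _ hpos, iterate_mod_minimalPeriod_eq⟩,
        fun h => absurd hx h⟩
    · exact ⟨_, fun h => absurd h hx, fun _ => rfl⟩
  choose f hf1 hf2 using hf
  have hlt : ∀ x, f x < r ↔ x ∈ periodicPts p := by
    intro x
    refine ⟨fun h => ?_, fun h => (hf1 x h).1⟩
    by_contra hx
    have := hf2 x hx
    omega
  have hfc : ∀ m, m < r → f (p^[m] c) = m := by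
    intro m hm
    obtain ⟨h1, h2⟩ := hf1 _ (iterate_mem_periodicPts hc m)
    exact (iterate_eq_iterate_iff_of_lt_minimalPeriod h1 hm).1 h2
  have hlev : ∀ x, f x - r = level p x := by
    intro x
    by_cases hx : x ∈ periodicPts p
    · rw [(level_eq_zero_iff hex x).2 hx]
      have := (hlt x).2 hx
      omega
    · rw [hf2 x hx]
      omega
  set σ := Tuple.sort f
  have hmono : Monotone (f ∘ σ) := Tuple.monotone_sort f
  have hcard : ∀ m, m ≤ r → (Finset.univ.filter fun i => (f ∘ σ) i < m).card = m := by
    intro m hm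
    conv_rhs => rw [← Finset.card_range m]
    refine Finset.card_bij (fun i _ => f (σ i)) (fun i hi => ?_) (fun i hi j hj hij => ?_)
      (fun b hb => ?_)
    · simpa using hi
    · rw [Finset.mem_filter_univ] at hi hj
      have h1 := (hf1 (σ i) ((hlt _).1 (hi.trans_le hm))).2
      have h2 := (hf1 (σ j) ((hlt _).1 (hj.trans_le hm))).2
      exact σ.injective (by rw [← h1, ← h2, hij])
    · rw [Finset.mem_range] at hb
      refine ⟨σ.symm (p^[b] c), ?_, ?_⟩
      · rw [Finset.mem_filter_univ, comp_apply, σ.apply_symm_apply, hfc b (hb.trans_le hm)]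
        exact hb
      · rw [σ.apply_symm_apply, hfc b (hb.trans_le hm)]
  have hσlt : ∀ (i : Fin n) m, m ≤ r → (f (σ i) < m ↔ (i : ℕ) < m) := by
    intro i m hm
    have := Tuple.lt_card_lt_iff_apply_lt_of_monotone (j := i) (a := m) hmono
    rw [hcard m hm] at this
    exact this.symm
  have hσ : ∀ i : Fin n, (i : ℕ) < r → σ i = p^[i] c := by
    intro i hi
    have h1 := (hσlt i (i + 1) hi).2 (Nat.lt_succ_self _)
    have h2 := (hσlt i i hi.le).not.2 (lt_irrefl _)
    have h3 : f (σ i) = i := by omega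
    have h4 := (hf1 (σ i) ((hlt _).1 (by omega))).2
    rw [← h4, h3]
  have hper : ∀ i : Fin n, σ i ∈ periodicPts p ↔ (i : ℕ) < r := fun i => by
    rw [← hlt, hσlt i r le_rfl]
  refine ⟨σ, σ.trans τ, fun i => level p (σ i), fun i j hij => ?_, fun i => ?_, fun j hj i => ?_,
    fun j hj => ?_⟩
  · have : f (σ i) ≤ f (σ j) := hmono hij
    simp only [← hlev]
    omega
  · rw [level_eq_zero_iff hex, hper]
  · simp only [Matrix.submatrix_apply, logMatrix_apply, Equiv.trans_apply, hv _, Finsupp.add_apply,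
      Finsupp.single_apply, σ.injective.eq_iff, eq_comm (b := i), eq_comm (b := σ i)]
    congr 2
    have hpj : p (σ j) = p^[((j : ℕ) + 1) % r] c := by
      rw [hσ j hj, ← iterate_succ_apply' p, hrdef, iterate_mod_minimalPeriod_eq]
    rw [hpj, eq_iff_iff]
    constructor
    · intro h
      have hi := (hper i).1 (h ▸ iterate_mem_periodicPts hc _)
      rw [hσ i hi] at h
      exact (iterate_eq_iterate_iff_of_lt_minimalPeriod hi (Nat.mod_lt _ hpos)).1 h
    · intro h
      rw [hσ i (h ▸ Nat.mod_lt _ hpos), h]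
  · have hj' : σ j ∉ periodicPts p := fun h => by
      have := (hper j).1 h
      omega
    refine ⟨σ.symm (p (σ j)), ?_, fun i => ?_⟩
    · simp only [σ.apply_symm_apply]
      exact level_apply_add_one hex hj'
    · simp only [Matrix.submatrix_apply, logMatrix_apply, Equiv.trans_apply, hv _,
        Finsupp.add_apply, Finsupp.single_apply, σ.injective.eq_iff, eq_comm (b := i),
        eq_comm (b := σ i), Equiv.eq_symm_apply]

end NormalForm

end MonomialCremona

/-! ### The structure of Cremona sets in degree two -/

open MonomialCremona

/-- `v` lists the exponent vectors of `F`, `w` those of `F⁻¹`, and `γ` is the inversion vector.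
`R` and `S` are the vertices and the edges of the root circuit, whose length is `R.card`. For
permutations `σ` of the variables and `τ` of the monomials of `F`, `(logMatrix v).submatrix σ τ` is
the permuted log-matrix, and `(logMatrix w).submatrix τ σ` is its Cremona inverse matrix. -/
theorem mainTheorem1 (k : Type*) [Field k] (n : ℕ) (hn : 2 ≤ n) (v : Fin n → Fin n →₀ ℕ)
    (hF : MonomialCremona.IsCremonaSet k 2 v) :
    ∃ (R S : Finset (Fin n)) (w : Fin n → Fin n →₀ ℕ) (γ : Fin n →₀ ℕ),
      -- the root circuit is unique, has odd length, and the log-matrix has a normal form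
      MonomialCremona.IsRootCircuit (MonomialCremona.graph v) R S ∧
      Odd R.card ∧
      (∃ σ τ : Equiv.Perm (Fin n),
        MonomialCremona.IsNormalForm R.card ((MonomialCremona.logMatrix v).submatrix σ τ)) ∧
      -- the inverse exists, is unique, and defines the inverse map with inversion factor `x^γ`
      MonomialCremona.IsCremonaInverse v w γ ∧
      (∀ w' γ', MonomialCremona.IsCremonaInverse v w' γ' → w' = w ∧ γ' = γ) ∧
      MonomialCremona.ComposesToId (MonomialCremona.monos k v) (MonomialCremona.monos k w)
        (MvPolynomial.monomial γ 1) ∧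
      (∃ h, MonomialCremona.ComposesToId (MonomialCremona.monos k w)
        (MonomialCremona.monos k v) h) ∧
      -- (a) the degree of the inverse
      MonomialCremona.HasMapDegree (MonomialCremona.monos k w)
        ((R.card + 1) / 2 +
          {x | x ∉ R ∧ 2 ≤ MonomialCremona.vertexDegree (MonomialCremona.graph v) x}.ncard) ∧
      -- (b) the entries of the Cremona inverse matrix, for every normal form of the log-matrix
      (∀ σ τ : Equiv.Perm (Fin n),
        MonomialCremona.IsNormalForm R.card ((MonomialCremona.logMatrix v).submatrix σ τ) →
        (∀ i, (MonomialCremona.logMatrix w).submatrix τ σ i i ≠ 0) ∧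
        (∀ i j, (MonomialCremona.logMatrix w).submatrix τ σ i j ∈ ({0, 1, 2} : Set ℕ)) ∧
        (∀ i, (∃ j, (MonomialCremona.logMatrix w).submatrix τ σ i j = 2) ↔
          σ i ∉ R ∧
            2 ≤ MonomialCremona.vertexDegree (MonomialCremona.graph v) (σ i))) ∧
      ((∀ j, Squarefree (MonomialCremona.monos k w j)) ↔
        MonomialCremona.neighborhood (MonomialCremona.graph v) (R : Set (Fin n)) 2 = ∅) ∧
      -- (c) the inversion factor
      (MvPolynomial.monomial γ 1 : MvPolynomial (Fin n) k) =
        (∏ x ∈ R, MvPolynomial.X x) *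
          ∏ e ∈ MonomialCremona.prunedEdgesOff (MonomialCremona.graph v) S,
            MonomialCremona.monos k v e := by
  have : NeZero n := ⟨by omega⟩
  have : Nontrivial (Fin n) := Fin.nontrivial_iff_two_le.2 hn

  have hdet := hF.birational.det_ne_zero
  obtain ⟨τ, p, hv⟩ := exists_isOrientation hF.stochastic hdet
  have hp := hF.birational.isOddUnicyclic hv
  obtain ⟨c, hc⟩ := exists_mem_periodicPts p
  have hinv := isCremonaInverse_invExponent hF.stochastic hdet hv hp
  have hinner : {x | x ∉ cycleFinset p ∧ 2 ≤ vertexDegree (graph v) x} = innerFinset p := by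
    ext x
    simp [hv.two_le_vertexDegree_iff, mem_innerFinset]
  refine ⟨cycleFinset p, (cycleFinset p).map τ.toEmbedding, invExponent p τ, inversionExponent p,
    isRootCircuit_cycle hv hp hc, ?_, exists_isNormalForm hv hp hc, hinv,
    fun w' γ' h' => hinv.unique hdet h', composesToId_of_mul_eq hinv.inversion,
    ⟨_, composesToId_of_mul_eq (γ := Finsupp.equivFunOnFinite.symm fun e =>
      rowConst p (τ.symm e)) (logMatrix_invExponent_mul hv hp)⟩, ?_, ?_, ?_, ?_⟩
  · rw [card_cycleFinset hp hc]
    exact hp.odd c hc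
  · rw [hinner, Set.ncard_coe_finset]
    exact hasMapDegree_monos (isStochastic_of_inversion hF.stochastic hinv.inversion)
      hinv.canonical
  · intro σ τ' hN
    -- The normal form orients the graph, possibly with the root circuit reversed. The inverse and
    -- the root circuit do not depend on the orientation.
    obtain ⟨p', hv'⟩ := hN.exists_isOrientation
      ((Finset.card_le_univ _).trans_eq (Fintype.card_fin n))
    have hp' := hF.birational.isOddUnicyclic hv'
    have hw := (hinv.unique hdet
      (isCremonaInverse_invExponent hF.stochastic hdet hv' hp')).1
    obtain ⟨c', hc'⟩ := exists_mem_periodicPts p'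
    have hR := (eq_cycle_of_isCircuit hv hp (isCircuit_cycle hv' hp' hc')).1
    have hW : ∀ i j, (logMatrix (invExponent p τ)).submatrix τ' σ i j =
        invWeight p' (σ i) (σ j) := by
      intro i j
      simp [← hw]
    simp only [hW, ← hR, mem_cycleFinset, hv'.two_le_vertexDegree_iff,
      ← exists_invWeight_eq_two_iff]
    refine ⟨fun i => invWeight_self_ne_zero _ _, fun i j => ?_, fun i => ?_⟩
    · have := invWeight_le_two p' (σ i) (σ j)
      simp only [Set.mem_insert_iff, Set.mem_singleton_iff]
      omega
    · exact σ.exists_congr_left.trans (by simp)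
  · rw [neighborhood_two_eq_empty_iff hv hp hc]
    simp only [monos, squarefree_monomial_iff, invExponent_apply]
    constructor
    · intro h y hy
      by_contra hyc
      obtain ⟨z, hz⟩ := (exists_invWeight_eq_two_iff p y).2 ⟨hyc, hy⟩
      have := h z (τ y)
      rw [τ.symm_apply_apply, hz] at this
      omega
    · intro h x e
      have h1 := invWeight_le_two p (τ.symm e) x
      have h2 : invWeight p (τ.symm e) x ≠ 2 := fun h2 =>
        have h3 := (exists_invWeight_eq_two_iff p (τ.symm e)).1 ⟨x, h2⟩
        h3.1 (h _ h3.2)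
      omega
  · rw [hv.prunedEdgesOff_eq]
    exact monomial_inversionExponent hv
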